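/- Let $K$ be a number field with algebraic closure $\bar K$. For a rational function $f\in\bar K(x)$ let $f^{\circ n}$ denote its $n$-th iterate under composition. For $n\ge 1$ put $$A_n(K)=\{f\in\bar K(x) : f^{\circ n}\in K(x)\},$$ and let $B(K)$ be the set of all $f\in\bar K(x)$ for which there is a fractional linear transformation $\ell\in\mathrm{PGL}_2(K)$ such that $$\ell^{-1}\circ f\circ\ell = a\,x^k g(x^t)$$ for some coprime positive integers $k,t$, some $g\in K(x)$ and some $a\in\bar K$ with $a^t\in K$. Proposition. Let $E$ be an elliptic curve over $\mathbb{Q}$ given by a Weierstrass equation $y^2=p(x)$, where $p(x)=x^3+a_2x^2+a_4x+a_6\in\mathbb{Q}[x]$ is irreducible over $\mathbb{Q}$. Let $d\ge 3$ be an odd integer and let $Q\in E(\bar{\mathbb{Q}})$ be a point of exact order $2$. Then there is a unique rational function $f\in\bar{\mathbb{Q}}(x)$ such that, as an equality in $\mathbb{P}_1(\bar{\mathbb{Q}})=\bar{\mathbb{Q}}\cup\{\infty\}$, $$x(dP+Q)=f(x(P))\qquad\text{for all } P\in E(\bar{\mathbb{Q}})$$ (where the point at infinity of $E$ has $x$-coordinate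 $\infty$), and this $f$ satisfies $$f\in A_2(\mathbb{Q})\setminus\bigl(\mathbb{Q}(x)\cup B(\mathbb{Q})\bigr).$$ -/

import Mathlib

noncomputable section

namespace IterateField

/-- The inclusion `K(x) → L(x)` for a field extension `L/K`. -/
def baseChange (K L : Type*) [Field K] [Field L] [Algebra K L] : RatFunc K →+* RatFunc L :=
  RatFunc.mapRingHom (Polynomial.mapRingHom (algebraMap K L))
    (nonZeroDivisors_le_comap_nonZeroDivisors_of_injective _
      (Polynomial.map_injective _ (algebraMap K L).injective))

/-- `K(x)` as a subset of `L(x)`. -/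
def definedOver (K L : Type*) [Field K] [Field L] [Algebra K L] : Set (RatFunc L) :=
  Set.range (baseChange K L)

/-- The composition `f ∘ g`, that is `f(g(x))`. -/
def comp {L : Type*} [Field L] (f g : RatFunc L) : RatFunc L :=
  RatFunc.eval RatFunc.C g f

/-- The iterates of `f`: the `0`-th one is `x`, and the `(n+1)`-st one is the `n`-th one
composed with `f`. -/
def iter {L : Type*} [Field L] (f : RatFunc L) : ℕ → RatFunc L
  | 0 => RatFunc.X
  | n + 1 => comp (iter f n) f

/-- `A_n(K)`: the rational functions over `L` whose `n`-th iterate is defined over `K`. -/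
def setA (K L : Type*) [Field K] [Field L] [Algebra K L] (n : ℕ) : Set (RatFunc L) :=
  {f | iter f n ∈ definedOver K L}

/-- The fractional linear transformation `(a x + b) / (c x + d)` with the entries of
`M = !![a, b; c, d]`. -/
def fracLin (K L : Type*) [Field K] [Field L] [Algebra K L]
    (M : Matrix.GeneralLinearGroup (Fin 2) K) : RatFunc L :=
  (RatFunc.C (algebraMap K L (M 0 0)) * RatFunc.X + RatFunc.C (algebraMap K L (M 0 1))) /
    (RatFunc.C (algebraMap K L (M 1 0)) * RatFunc.X + RatFunc.C (algebraMap K L (M 1 1)))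

/-- `g` is `K`-linearly conjugate to `f`: `g = ℓ⁻¹ ∘ f ∘ ℓ` for some `ℓ` in `PGL₂(K)`. -/
def LinConj (K : Type*) {L : Type*} [Field K] [Field L] [Algebra K L] (f g : RatFunc L) : Prop :=
  ∃ M : Matrix.GeneralLinearGroup (Fin 2) K,
    g = comp (fracLin K L M⁻¹) (comp f (fracLin K L M))

/-- `B(K)`: the rational functions over `L` that are `K`-linearly conjugate to some
`a x ^ k g(x ^ t)` with `k, t` positive and coprime, `g` in `K(x)` and `a ^ t` in `K`. -/
def setB (K L : Type*) [Field K] [Field L] [Algebra K L] : Set (RatFunc L) :=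
  {f | ∃ (a : L) (k t : ℕ) (g : RatFunc K), 0 < k ∧ 0 < t ∧ k.Coprime t ∧
    a ^ t ∈ Set.range (algebraMap K L) ∧
    LinConj K f
      (RatFunc.C a * RatFunc.X ^ k * comp (baseChange K L g) (RatFunc.X ^ t))}

open Classical in
/-- The self-map of the projective line `L ∪ {∞}` given by a rational function. At `∞` it is the
limit of `f`, read off from the degrees and the leading coefficients. -/
def evalP1 {L : Type*} [Field L] (f : RatFunc L) : OnePoint L → OnePoint L
  | none =>
      if f.denom.natDegree < f.num.natDegree then OnePoint.infty
      else ((f.num.coeff f.denom.natDegree / f.denom.leadingCoeff : L) : OnePoint L)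
  | some x =>
      if f.denom.eval x = 0 then OnePoint.infty
      else ((f.num.eval x / f.denom.eval x : L) : OnePoint L)

/-- The `x`-coordinate `E(L) → L ∪ {∞}`; the point at infinity goes to `∞`. -/
def xCoord {L : Type*} [Field L] {E : WeierstrassCurve.Affine L} : E.Point → OnePoint L
  | .zero => OnePoint.infty
  | .some x _ _ => (x : OnePoint L)

/-- The map `Ψ` from `E(L)` to itself descends through the `x`-coordinate to `f`:
`x(Ψ(P)) = f(x(P))` for all `P`. -/
def DescendsTo {L : Type*} [Field L] {E : WeierstrassCurve.Affine L} (Ψ : E.Point → E.Point)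
    (f : RatFunc L) : Prop :=
  ∀ P : E.Point, xCoord (Ψ P) = evalP1 f (xCoord P)

end IterateField

end

/-! Put `Ψ(P) = dP + Q`. As `d` is odd and `2Q = 0`, `dQ = Q` and `Ψ ∘ Ψ = [d²]`. Hence `f ∘ f` is
the map that `[d²]` induces on `x`-coordinates, and this has rational coefficients (`exists_isMulX`,
`DescendsTo.mem_setA_two`).

For the negative part, write `Q = (r, 0)` with `r` a root of the irreducible cubic `p`. Translation
by `Q` acts on `x`-coordinates as the Möbius map `x ↦ r + p'(r)/(x - r)`, so `f` is this map applied
to the rational function `A / B` of `[d]`. If `f` took a rational point of `ℙ¹` to a rational point,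
then `r` would satisfy a nontrivial rational equation of degree at most two
(`exists_hasValue_lattes`, `lattes_at_infty`). A function over `ℚ` does take rational points to
rational points. A member of `B(ℚ)` takes at least one: if `a x^k g(x^t)` is nonzero, its order at
`0` is congruent to `k` modulo `t`, so `0` goes to `0` or `∞` unless `t = 1`, and then `a` is
rational and so is the function (`mem_range_of_hasValue_zero`, `notMem_setB`).

Uniqueness holds because `x` maps `E` onto `ℙ¹` over an algebraically closed field. -/

namespace WeierstrassCurve

/-! ### Sum and product of `x(P + R)` and `x(P - R)` -/

section AddSub

variable {F : Type*} [Field F] [DecidableEq F] {W : WeierstrassCurve.Affine F}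

/-- Negating the second point changes only the sign of the term `2 * y₁ * y₂`. The sum and the
product of the two resulting `x`-coordinates therefore depend on `x₁` and `x₂` alone. -/
lemma addX_slope_of_X_ne (ha₁ : W.a₁ = 0) (ha₃ : W.a₃ = 0) {x₁ x₂ y₁ y₂ : F} (hx : x₁ ≠ x₂)
    (h₁ : W.Equation x₁ y₁) (h₂ : W.Equation x₂ y₂) :
    W.addX x₁ x₂ (W.slope x₁ x₂ y₁ y₂) * (x₁ - x₂) ^ 2 =
      (x₁ + x₂) * (W.a₄ + x₁ * x₂) + 2 * W.a₂ * x₁ * x₂ + 2 * W.a₆ - 2 * y₁ * y₂ := by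
  have hx' := sub_ne_zero.mpr hx
  rw [Affine.equation_iff] at h₁ h₂
  simp only [ha₁, ha₃] at h₁ h₂
  rw [Affine.slope_of_X_ne hx, Affine.addX, ha₁]
  field_simp
  linear_combination h₁ + h₂

lemma addX_slope_self (ha₁ : W.a₁ = 0) (ha₃ : W.a₃ = 0) {x y : F} (hy : y ≠ W.negY x y) :
    W.addX x x (W.slope x x y y) * (2 * y) ^ 2 =
      (3 * x ^ 2 + 2 * W.a₂ * x + W.a₄) ^ 2 - (2 * x + W.a₂) * (2 * y) ^ 2 := by
  have hy' : y - W.negY x y = 2 * y := by rw [Affine.negY, ha₁, ha₃]; ring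
  have hy0 : 2 * y ≠ 0 := hy' ▸ sub_ne_zero.mpr hy
  rw [Affine.slope_of_Y_ne rfl hy, hy', Affine.addX, ha₁]
  generalize 2 * y = z at *
  field_simp
  ring

/-- The product of the `x`-coordinates of the sum and the difference of two points with
`x`-coordinates `(a : b)` and `(x : 1)`, up to the factor `addSubZ`. -/
def addSubX {R : Type*} [CommRing R] (W : WeierstrassCurve R) (a b x : R) : R :=
  (a * x - W.a₄ * b) ^ 2 - 4 * W.a₆ * b * (a + b * x + W.a₂ * b)

/-- The sum of the `x`-coordinates of the sum and the difference of two points with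
`x`-coordinates `(a : b)` and `(x : 1)`, up to the factor `addSubZ`. -/
def addSubY {R : Type*} [CommRing R] (W : WeierstrassCurve R) (a b x : R) : R :=
  2 * (a + b * x) * (W.a₄ * b + a * x) + 4 * W.a₂ * a * x * b + 4 * W.a₆ * b ^ 2

/-- The common denominator of `addSubX` and `addSubY`. -/
def addSubZ {R : Type*} [CommRing R] (a b x : R) : R :=
  (a - b * x) ^ 2

/-- Projective form of the symmetric functions of `x(P + R)` and `x(P - R)`. The common factor `c`
lets one statement cover the cases where `P`, `P + R` or `P - R` is the point at infinity. -/
lemma exists_addSub_eq (ha₁ : W.a₁ = 0) (ha₃ : W.a₃ = 0) (P : W.Point) {x y : F}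
    (h : W.Nonsingular x y) :
    ∃ c ≠ 0,
      W.addSubX (P.xRep 0) (P.xRep 1) x =
        c * ((P + .some x y h).xRep 0 * (P - .some x y h).xRep 0) ∧
      W.addSubY (P.xRep 0) (P.xRep 1) x =
        c * ((P + .some x y h).xRep 0 * (P - .some x y h).xRep 1 +
          (P + .some x y h).xRep 1 * (P - .some x y h).xRep 0) ∧
      addSubZ (P.xRep 0) (P.xRep 1) x =
        c * ((P + .some x y h).xRep 1 * (P - .some x y h).xRep 1) := by
  rcases P with _ | ⟨x₁, y₁, h₁⟩
  · refine ⟨1, one_ne_zero, ?_⟩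
    rw [← Affine.Point.zero_def, zero_add, zero_sub, Affine.Point.xRep_neg]
    simp [addSubX, addSubY, addSubZ]
    grind
  have e₁ := (Affine.equation_iff ..).mp h₁.1
  have e := (Affine.equation_iff ..).mp h.1
  simp only [ha₁, ha₃, zero_mul, add_zero] at e₁ e
  by_cases hx : x₁ = x
  · subst hx
    -- Replacing `y` by `-y` exchanges sum and difference, and all three identities are symmetric in
    -- them.
    wlog hs : y₁ = y generalizing y
    · have hs' : y₁ = -y := by
        have : (y₁ - y) * (y₁ + y) = 0 := by linear_combination e₁ - e
        rcases mul_eq_zero.mp this with h | h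
        · exact absurd (sub_eq_zero.mp h) hs
        · exact eq_neg_of_add_eq_zero_left h
      have hn : W.negY x₁ y = -y := by rw [Affine.negY, ha₁, ha₃]; ring
      obtain ⟨c, hc, h1, h2, h3⟩ := this ((Affine.nonsingular_neg ..).mpr h)
        (by rw [hn]; linear_combination e) (by rw [hn, hs'])
      rw [← Affine.Point.neg_some h] at h1 h2 h3
      rw [← sub_eq_add_neg, sub_neg_eq_add] at h1 h2 h3
      exact ⟨c, hc, by rw [h1]; ring, by rw [h2]; ring, by rw [h3]; ring⟩
    subst hs
    rw [sub_self]
    by_cases hy : y₁ = W.negY x₁ y₁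
    · rw [Affine.Point.add_self_of_Y_eq hy]
      have hy0 : 2 * y₁ = 0 := by
        rw [Affine.negY, ha₁, ha₃] at hy; linear_combination hy
      have hd : 3 * x₁ ^ 2 + 2 * W.a₂ * x₁ + W.a₄ ≠ 0 := by
        have := ((Affine.nonsingular_iff' ..).mp h).2
        simp only [ha₁, ha₃, hy0] at this
        rcases this with h0 | h0
        · intro h1; exact h0 (by rw [h1]; ring)
        · simp at h0
      -- Here sum and difference are both `0`, so `c` must be the value of `addSubX`; modulo `2 * y₁
      -- = 0` and the equation of the curve this is `p'(x₁)²`.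
      refine ⟨(3 * x₁ ^ 2 + 2 * W.a₂ * x₁ + W.a₄) ^ 2, pow_ne_zero 2 hd, ?_, ?_, ?_⟩
      · simp [addSubX]
        linear_combination -(2 * x₁ + W.a₂) * (2 * y₁) * hy0 + 4 * (2 * x₁ + W.a₂) * e
      · simp [addSubY]
        linear_combination 2 * y₁ * hy0 - 4 * e
      · simp [addSubZ]
    · rw [Affine.Point.add_self_of_Y_ne hy]
      have hA := addX_slope_self ha₁ ha₃ hy
      have hy0 : 2 * y₁ ≠ 0 := by
        intro h0; apply hy
        rw [Affine.negY, ha₁, ha₃]; linear_combination h0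
      refine ⟨(2 * y₁) ^ 2, pow_ne_zero 2 hy0, ?_, ?_, ?_⟩
      · simp only [addSubX, Affine.Point.xRep_some, Affine.Point.xRep_zero, Matrix.cons_val_zero,
          Matrix.cons_val_one, mul_one]
        linear_combination -hA + 4 * (2 * x₁ + W.a₂) * e
      · simp [addSubY]
        linear_combination -4 * e
      · simp [addSubZ]
  · have hx' := sub_ne_zero.mpr hx
    rw [sub_eq_add_neg, Affine.Point.neg_some, Affine.Point.add_of_X_ne hx,
      Affine.Point.add_of_X_ne hx]
    have hA := addX_slope_of_X_ne ha₁ ha₃ hx h₁.1 h.1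
    have hB := addX_slope_of_X_ne ha₁ ha₃ hx h₁.1 ((Affine.equation_neg ..).mpr h.1)
    have hn : W.negY x y = -y := by rw [Affine.negY, ha₁, ha₃]; ring
    rw [hn] at hB
    simp only [hn, Affine.Point.xRep_some]
    generalize W.addX x₁ x (W.slope x₁ x y₁ y) = s at *
    generalize W.addX x₁ x (W.slope x₁ x y₁ (-y)) = t at *
    refine ⟨(x₁ - x) ^ 2, pow_ne_zero 2 hx', ?_, ?_, ?_⟩
    · simp only [addSubX, Matrix.cons_val_zero, Matrix.cons_val_one, mul_one, one_mul]
      apply mul_right_cancel₀ (pow_ne_zero 2 hx')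
      have : (x₁ - x) ^ 2 * (s * t) * (x₁ - x) ^ 2 = (s * (x₁ - x) ^ 2) * (t * (x₁ - x) ^ 2) := by
        ring
      rw [this, hA, hB]
      linear_combination 4 * y₁ ^ 2 * e + 4 * (x ^ 3 + W.a₂ * x ^ 2 + W.a₄ * x + W.a₆) * e₁
    · simp only [addSubY, Matrix.cons_val_zero, Matrix.cons_val_one, mul_one, one_mul]
      linear_combination -hA - hB
    · simp [addSubZ]

end AddSub

end WeierstrassCurve

namespace WeierstrassCurve

/-! ### Multiplication by `n` on `x`-coordinates, over the base field -/

section MulByNat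

open Polynomial

lemma Affine.Point.xRep_eq_or {R : Type*} [CommRing R] {W : WeierstrassCurve.Affine R}
    (P : W.Point) : (P.xRep 0 = 1 ∧ P.xRep 1 = 0) ∨ P.xRep 1 = 1 := by
  cases P <;> simp [← Affine.Point.zero_def]

lemma Affine.Point.exists_eq_mul_xRep {K : Type*} [Field K] {W : WeierstrassCurve.Affine K}
    (P : W.Point) {a b : K} (hab : a ≠ 0 ∨ b ≠ 0) (h : P.xRep 1 * a = P.xRep 0 * b) :
    ∃ c ≠ 0, a = c * P.xRep 0 ∧ b = c * P.xRep 1 := by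
  rcases P.xRep_eq_or with ⟨h0, h1⟩ | h1
  · rw [h0, h1, zero_mul, one_mul] at h
    exact ⟨a, by simpa [← h] using hab, by rw [h0, mul_one], by rw [h1, mul_zero, h]⟩
  · rw [h1, one_mul] at h
    refine ⟨b, ?_, by rw [h, mul_comm], by rw [h1, mul_one]⟩
    rintro rfl
    simp [h] at hab

lemma exists_nonsingular {K : Type*} [Field K] [IsAlgClosed K] (W : WeierstrassCurve.Affine K)
    [W.IsElliptic] (ha₁ : W.a₁ = 0) (ha₃ : W.a₃ = 0) (x : K) : ∃ y, W.Nonsingular x y := by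
  obtain ⟨y, hy⟩ := IsAlgClosed.exists_pow_nat_eq (x ^ 3 + W.a₂ * x ^ 2 + W.a₄ * x + W.a₆)
    (n := 2) two_pos
  refine ⟨y, Affine.equation_iff_nonsingular.mp ((Affine.equation_iff ..).mpr ?_)⟩
  rw [ha₁, ha₃, hy]
  ring

variable {F K : Type*} [Field F] [Field K] [Algebra F K]

/-- The polynomial `addSubX` in `x`, for a point `(a : b)` of `ℙ¹` depending on `x`. -/
noncomputable def polyAddSubX (W : WeierstrassCurve F) (A B : F[X]) : F[X] := (W.map C).addSubX A B X

/-- The polynomial `addSubY` in `x`, for a point `(a : b)` of `ℙ¹` depending on `x`. -/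
noncomputable def polyAddSubY (W : WeierstrassCurve F) (A B : F[X]) : F[X] := (W.map C).addSubY A B X

/-- The polynomial `addSubZ` in `x`, for a point `(a : b)` of `ℙ¹` depending on `x`. -/
noncomputable def polyAddSubZ (A B : F[X]) : F[X] := addSubZ A B X

lemma aeval_polyAddSubX (W : WeierstrassCurve F) (A B : F[X]) (x : K) :
    aeval x (W.polyAddSubX A B) = (W.baseChange K).addSubX (aeval x A) (aeval x B) x := by
  simp [polyAddSubX, addSubX, map_ofNat]

lemma aeval_polyAddSubY (W : WeierstrassCurve F) (A B : F[X]) (x : K) :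
    aeval x (W.polyAddSubY A B) = (W.baseChange K).addSubY (aeval x A) (aeval x B) x := by
  simp [polyAddSubY, addSubY, map_ofNat]

lemma aeval_polyAddSubZ (A B : F[X]) (x : K) :
    aeval x (polyAddSubZ A B) = addSubZ (aeval x A) (aeval x B) x := by
  simp [polyAddSubZ, addSubZ]

/-- The leading term of `polyAddSubX` is `(A * X) ^ 2`, and `polyAddSubY` has smaller degree. This
carries the condition `degree_lt`, that `∞` goes to `∞`, through the recursion. -/
lemma natDegree_polyAddSubX (W : WeierstrassCurve F) {A B : F[X]} (h : B.degree < A.degree) :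
    (W.polyAddSubX A B).natDegree = 2 * A.natDegree + 2 ∧
      (W.polyAddSubY A B).natDegree ≤ 2 * A.natDegree + 1 := by
  have hA : A ≠ 0 := by rintro rfl; simp at h
  have hB : B.natDegree ≤ A.natDegree := natDegree_le_natDegree h.le
  have hBX : (B * X).natDegree ≤ A.natDegree := by
    obtain rfl | hB := eq_or_ne B 0
    · simp
    · rw [natDegree_mul_X hB]
      exact natDegree_lt_natDegree hB h
  have hm (c : F) {P Q : F[X]} (hP : P.natDegree ≤ A.natDegree) (hQ : Q.natDegree ≤ A.natDegree) :
      (C c * (P * Q)).natDegree ≤ 2 * A.natDegree := by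
    rw [two_mul]
    exact (natDegree_C_mul_le _ _).trans (natDegree_mul_le_of_le hP hQ)
  have ha {P Q : F[X]} {m : ℕ} (hP : P.natDegree ≤ m) (hQ : Q.natDegree ≤ m) :
      (P + Q).natDegree ≤ m := natDegree_add_le_of_degree_le hP hQ
  have hc2 : (C 2 : F[X]) = 2 := map_ofNat C 2
  have hc4 : (C 4 : F[X]) = 4 := map_ofNat C 4
  constructor
  · have e : W.polyAddSubX A B = (A * X) ^ 2 + (C (-2 * W.a₄) * (A * (B * X)) +
        C (W.a₄ ^ 2 - 4 * W.a₆ * W.a₂) * (B * B) + C (-4 * W.a₆) * (B * A) +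
        C (-4 * W.a₆) * (B * (B * X))) := by
      simp only [polyAddSubX, addSubX, map_a₂, map_a₄, map_a₆, map_mul, map_sub, map_neg, map_pow,
        hc2, hc4]
      ring
    have e' : ((A * X) ^ 2).natDegree = 2 * A.natDegree + 2 := by
      rw [natDegree_pow, natDegree_mul_X hA]
      ring
    rw [e, natDegree_add_eq_left_of_natDegree_lt, e']
    have := ha (ha (ha (hm (-2 * W.a₄) le_rfl hBX) (hm (W.a₄ ^ 2 - 4 * W.a₆ * W.a₂) hB hB))
      (hm (-4 * W.a₆) hB le_rfl)) (hm (-4 * W.a₆) hB hBX)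
    omega
  · have e : W.polyAddSubY A B = (C 2 * (A * A) + C 2 * (A * (B * X))) * X +
        (C (2 * W.a₄) * (A * B) + C (2 * W.a₄) * (B * (B * X)) + C (4 * W.a₂) * (A * (B * X)) +
        C (4 * W.a₆) * (B * B)) := by
      simp only [polyAddSubY, addSubY, map_a₂, map_a₄, map_a₆, map_mul, hc2, hc4]
      ring
    rw [e]
    refine ha (natDegree_mul_le_of_le (ha (hm _ le_rfl le_rfl) (hm _ le_rfl hBX)) natDegree_X_le)
      ((ha (ha (ha (hm _ le_rfl hB) (hm _ hB hBX)) (hm _ le_rfl hBX)) (hm _ hB hB)).trans ?_)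
    omega

/-- The fraction `A / B` is in lowest terms, takes the value `∞` at `∞`, and gives the
`x`-coordinate of `n` times a point in terms of that of the point. -/
structure IsMulX [DecidableEq K] (W : WeierstrassCurve F) (n : ℕ) (A B : F[X]) : Prop where
  isCoprime : IsCoprime A B
  degree_lt : B.degree < A.degree
  xRep_mul : ∀ {x y : K} (h : (W.baseChange K).toAffine.Nonsingular x y),
    (n • Affine.Point.some x y h).xRep 1 * aeval x A =
      (n • Affine.Point.some x y h).xRep 0 * aeval x B

lemma aeval_ne_zero_or_of_isCoprime {A B : F[X]} (h : IsCoprime A B) (x : K) :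
    aeval x A ≠ 0 ∨ aeval x B ≠ 0 := by
  obtain ⟨u, v, h⟩ := h
  by_contra! h0
  simpa [h0.1, h0.2] using congrArg (aeval x) h

variable [DecidableEq K]

variable (K) in
lemma isMulX_zero (W : WeierstrassCurve F) : IsMulX (K := K) W 0 1 0 where
  isCoprime := isCoprime_one_left
  degree_lt := by simp
  xRep_mul _ := by simp

variable (K) in
lemma isMulX_one (W : WeierstrassCurve F) : IsMulX (K := K) W 1 X 1 where
  isCoprime := isCoprime_one_right
  degree_lt := by simp
  xRep_mul _ := by simp

variable {W : WeierstrassCurve F}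

lemma IsMulX.exists_eq {n : ℕ} {A B : F[X]} (h : IsMulX (K := K) W n A B) {x y : K}
    (hxy : (W.baseChange K).toAffine.Nonsingular x y) :
    ∃ c ≠ 0, aeval x A = c * (n • Affine.Point.some x y hxy).xRep 0 ∧
      aeval x B = c * (n • Affine.Point.some x y hxy).xRep 1 :=
  Affine.Point.exists_eq_mul_xRep _ (aeval_ne_zero_or_of_isCoprime h.isCoprime x) (h.xRep_mul hxy)

lemma IsMulX.exists_addSub_eq (ha₁ : W.a₁ = 0) (ha₃ : W.a₃ = 0) {n : ℕ} {A₀ B₀ A₁ B₁ : F[X]}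
    (h₀ : IsMulX (K := K) W n A₀ B₀) (h₁ : IsMulX (K := K) W (n + 1) A₁ B₁) {x y : K}
    (hxy : (W.baseChange K).toAffine.Nonsingular x y) :
    ∃ c ≠ 0,
      aeval x (W.polyAddSubX A₁ B₁) =
        c * (((n + 2) • Affine.Point.some x y hxy).xRep 0 * aeval x A₀) ∧
      aeval x (W.polyAddSubY A₁ B₁) =
        c * (((n + 2) • Affine.Point.some x y hxy).xRep 0 * aeval x B₀ +
          ((n + 2) • Affine.Point.some x y hxy).xRep 1 * aeval x A₀) ∧
      aeval x (polyAddSubZ A₁ B₁) =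
        c * (((n + 2) • Affine.Point.some x y hxy).xRep 1 * aeval x B₀) := by
  obtain ⟨c₀, hc₀, hA₀, hB₀⟩ := h₀.exists_eq hxy
  obtain ⟨c₁, hc₁, hA₁, hB₁⟩ := h₁.exists_eq hxy
  obtain ⟨c, hc, hX, hY, hZ⟩ := WeierstrassCurve.exists_addSub_eq
    (W := (W.baseChange K).toAffine) (by simp [ha₁]) (by simp [ha₃])
    ((n + 1) • Affine.Point.some x y hxy) hxy
  have e₂ : (n + 1) • Affine.Point.some x y hxy + Affine.Point.some x y hxy =
      (n + 2) • Affine.Point.some x y hxy := (succ_nsmul ..).symm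
  have e₀ : (n + 1) • Affine.Point.some x y hxy - Affine.Point.some x y hxy =
      n • Affine.Point.some x y hxy := by rw [succ_nsmul, add_sub_cancel_right]
  rw [e₀, e₂] at hX hY hZ
  -- The forms are quadratic in `(A₁, B₁)`, which gives `c₁ ^ 2`, while the right-hand sides are
  -- linear in `(A₀, B₀)`, which gives `1 / c₀`.
  refine ⟨c * c₁ ^ 2 / c₀, by positivity, ?_, ?_, ?_⟩
  · rw [aeval_polyAddSubX, hA₀, hA₁, hB₁]
    field_simp
    simp only [addSubX] at hX ⊢
    linear_combination c₁ ^ 2 * hX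
  · rw [aeval_polyAddSubY, hA₀, hB₀, hA₁, hB₁]
    field_simp
    simp only [addSubY] at hY ⊢
    linear_combination c₁ ^ 2 * hY
  · rw [aeval_polyAddSubZ, hB₀, hA₁, hB₁]
    field_simp
    simp only [addSubZ] at hZ ⊢
    linear_combination c₁ ^ 2 * hZ

lemma eq_of_aeval_eq (F K : Type*) [Field F] [Field K] [Algebra F K] [IsAlgClosed K] {A B : F[X]}
    (h : ∀ x : K, aeval x A = aeval x B) : A = B := by
  apply Polynomial.map_injective _ (algebraMap F K).injective
  have := IsAlgClosed.instInfinite (K := K)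
  exact Polynomial.funext fun x => by simpa using h x

/-- The points `(n + 2)P` and `nP` are the sum and difference of `(n + 1)P` and `P`. Their
`x`-coordinates are the two roots of a quadratic form with coefficients `T`, `V`, `U`; one root `(A₀
: B₀)` is known, and the other is `(U A₀ : V A₀ - U B₀)`, to be reduced to lowest terms. -/
lemma IsMulX.exists_add_two [IsAlgClosed K] [W.IsElliptic] (ha₁ : W.a₁ = 0) (ha₃ : W.a₃ = 0)
    {n : ℕ} {A₀ B₀ A₁ B₁ : F[X]} (h₀ : IsMulX (K := K) W n A₀ B₀)
    (h₁ : IsMulX (K := K) W (n + 1) A₁ B₁) : ∃ A B, IsMulX (K := K) W (n + 2) A B := by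
  obtain ⟨dX, dY⟩ := W.natDegree_polyAddSubX h₁.degree_lt
  -- `(A₀ : B₀)` is a root of the quadratic form; an identity of polynomials may be checked at all
  -- points of `K`.
  have hrel : A₀ ^ 2 * polyAddSubZ A₁ B₁ - A₀ * B₀ * W.polyAddSubY A₁ B₁ +
      B₀ ^ 2 * W.polyAddSubX A₁ B₁ = 0 := by
    apply eq_of_aeval_eq F K
    intro x
    have : (W.baseChange K).toAffine.IsElliptic := 
      inferInstanceAs (W.map (algebraMap F K)).IsElliptic
    obtain ⟨y, hxy⟩ := exists_nonsingular (W.baseChange K).toAffine (by simp [ha₁]) (by simp [ha₃]) x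
    obtain ⟨c, -, hX, hY, hZ⟩ := h₀.exists_addSub_eq ha₁ ha₃ h₁ hxy
    simp only [map_add, map_sub, map_mul, map_pow, map_zero, hX, hY, hZ]
    ring
  have hXYZ {x y : K} (hxy) := h₀.exists_addSub_eq ha₁ ha₃ h₁ (x := x) (y := y) hxy
  generalize W.polyAddSubX A₁ B₁ = U at *
  generalize W.polyAddSubY A₁ B₁ = V at *
  generalize polyAddSubZ A₁ B₁ = T at *
  have hA₀ : A₀ ≠ 0 := by rintro rfl; simpa using h₀.degree_lt
  have hU : U ≠ 0 := by rintro rfl; simp at dX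
  have hlt : (V * A₀ - U * B₀).degree < (U * A₀).degree := by
    refine (degree_sub_le _ _).trans_lt (max_lt ?_ ?_)
    · rw [degree_mul, degree_mul, degree_eq_natDegree hA₀, degree_eq_natDegree hU]
      obtain rfl | hV := eq_or_ne V 0
      · rw [degree_zero, WithBot.bot_add]; exact WithBot.bot_lt_coe _
      rw [degree_eq_natDegree hV]
      norm_cast
      omega
    · rw [degree_mul, degree_mul, degree_eq_natDegree hU]
      exact WithBot.add_lt_add_left (by simp) h₀.degree_lt
  have hne : U * A₀ ≠ 0 := mul_ne_zero hU hA₀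
  obtain ⟨G, A, B, hAB, hG, hA, hB⟩ : ∃ G A B : F[X], IsCoprime A B ∧ G ≠ 0 ∧
      U * A₀ = G * A ∧ V * A₀ - U * B₀ = G * B := by
    classical
    obtain ⟨A, hA⟩ := EuclideanDomain.gcd_dvd_left (U * A₀) (V * A₀ - U * B₀)
    obtain ⟨B, hB⟩ := EuclideanDomain.gcd_dvd_right (U * A₀) (V * A₀ - U * B₀)
    have hG : EuclideanDomain.gcd (U * A₀) (V * A₀ - U * B₀) ≠ 0 := fun h0 => hne (by
      rw [hA, h0, zero_mul])
    have h := EuclideanDomain.gcd_eq_gcd_ab (U * A₀) (V * A₀ - U * B₀)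
    generalize EuclideanDomain.gcd (U * A₀) (V * A₀ - U * B₀) = G at *
    generalize EuclideanDomain.gcdA (U * A₀) (V * A₀ - U * B₀) = a at *
    generalize EuclideanDomain.gcdB (U * A₀) (V * A₀ - U * B₀) = b at *
    exact ⟨G, A, B, ⟨a, b, mul_left_cancel₀ hG (by linear_combination -h - a * hA - b * hB)⟩,
      hG, hA, hB⟩
  have hdeg : B.degree < A.degree := by
    rw [hA, hB, degree_mul, degree_mul] at hlt
    exact lt_of_add_lt_add_left hlt
  -- The pair `(U A₀, V A₀ - U B₀)` vanishes where `A₀` does. After cancelling `G`, `r₁` determines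
  -- `(A : B)` where `A₀ ≠ 0`, and `r₂` where `A₀ = 0`, hence `B₀ ≠ 0`.
  have r₁ : A₀ * A * V = (A * B₀ + A₀ * B) * U :=
    mul_left_cancel₀ hG (by linear_combination (-A₀ * V + B₀ * U) * hA + A₀ * U * hB)
  have r₂ : (A * B₀ + A₀ * B) * T = B₀ * B * V :=
    mul_left_cancel₀ hG (by
      linear_combination (-B₀ * T) * hA + (-A₀ * T + B₀ * V) * hB + V * hrel)
  refine ⟨A, B, hAB, hdeg, fun {x y} hxy => ?_⟩
  obtain ⟨c, hc, hX, hY, hZ⟩ := hXYZ hxy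
  replace r₁ := congrArg (aeval x) r₁
  replace r₂ := congrArg (aeval x) r₂
  simp only [map_add, map_mul, hX, hY, hZ] at r₁ r₂
  by_cases h0 : aeval x A₀ = 0
  · have hb : aeval x B₀ ≠ 0 :=
      (aeval_ne_zero_or_of_isCoprime h₀.isCoprime x).resolve_left (not_not.mpr h0)
    rw [h0] at r₂
    refine mul_left_cancel₀ (mul_ne_zero hc (pow_ne_zero 2 hb)) ?_
    linear_combination r₂
  · refine mul_left_cancel₀ (mul_ne_zero hc (pow_ne_zero 2 h0)) ?_
    linear_combination r₁

theorem exists_isMulX (K : Type*) [Field K] [Algebra F K] [DecidableEq K] [IsAlgClosed K]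
    [W.IsElliptic] (ha₁ : W.a₁ = 0) (ha₃ : W.a₃ = 0) (n : ℕ) :
    ∃ A B, IsMulX (K := K) W n A B := by
  induction n using Nat.twoStepInduction with
  | zero => exact ⟨_, _, isMulX_zero K W⟩
  | one => exact ⟨_, _, isMulX_one K W⟩
  | more n h₀ h₁ =>
    obtain ⟨A₀, B₀, h₀⟩ := h₀
    obtain ⟨A₁, B₁, h₁⟩ := h₁
    exact h₀.exists_add_two ha₁ ha₃ h₁

end MulByNat

end WeierstrassCurve

namespace IterateField

open Polynomial

/-! ### Finite values of rational functions -/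

section HasValue

variable {L : Type*} [Field L]

/-- The rational function `f` has no pole at `x` and takes the value `v` there. -/
def HasValue (f : RatFunc L) (x v : L) : Prop :=
  ∃ N D : L[X], D.eval x ≠ 0 ∧ f = algebraMap L[X] (RatFunc L) N / algebraMap L[X] (RatFunc L) D ∧
    v * D.eval x = N.eval x

lemma algebraMap_ne_zero_of_eval_ne_zero {D : L[X]} {x : L} (h : D.eval x ≠ 0) :
    algebraMap L[X] (RatFunc L) D ≠ 0 :=
  RatFunc.algebraMap_ne_zero (by rintro rfl; simp at h)

lemma hasValue_div (N : L[X]) {D : L[X]} {x : L} (h : D.eval x ≠ 0) :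
    HasValue (algebraMap L[X] (RatFunc L) N / algebraMap L[X] (RatFunc L) D) x
      (N.eval x / D.eval x) :=
  ⟨N, D, h, rfl, div_mul_cancel₀ _ h⟩

lemma hasValue_algebraMap (N : L[X]) (x : L) :
    HasValue (algebraMap L[X] (RatFunc L) N) x (N.eval x) := by
  simpa using hasValue_div N (D := 1) (x := x) (by simp)

lemma hasValue_C (c x : L) : HasValue (RatFunc.C c) x c := by
  simpa using hasValue_algebraMap (C c) x

lemma hasValue_X (x : L) : HasValue RatFunc.X x x := by
  simpa using hasValue_algebraMap (X : L[X]) x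

variable {f g : RatFunc L} {x v w : L}

lemma HasValue.add (hf : HasValue f x v) (hg : HasValue g x w) : HasValue (f + g) x (v + w) := by
  obtain ⟨N, D, hD, rfl, h⟩ := hf
  obtain ⟨N', D', hD', rfl, h'⟩ := hg
  refine ⟨N * D' + D * N', D * D', by simp [hD, hD'], ?_, ?_⟩
  · rw [div_add_div _ _ (algebraMap_ne_zero_of_eval_ne_zero hD)
      (algebraMap_ne_zero_of_eval_ne_zero hD')]
    simp
  · simp only [eval_add, eval_mul]
    linear_combination D'.eval x * h + D.eval x * h'

lemma HasValue.mul (hf : HasValue f x v) (hg : HasValue g x w) : HasValue (f * g) x (v * w) := by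
  obtain ⟨N, D, hD, rfl, h⟩ := hf
  obtain ⟨N', D', hD', rfl, h'⟩ := hg
  refine ⟨N * N', D * D', by simp [hD, hD'], by simp [div_mul_div_comm], ?_⟩
  simp only [eval_mul]
  linear_combination w * D'.eval x * h + N.eval x * h'

lemma HasValue.inv (hf : HasValue f x v) (hv : v ≠ 0) : HasValue f⁻¹ x v⁻¹ := by
  obtain ⟨N, D, hD, rfl, h⟩ := hf
  refine ⟨D, N, h ▸ mul_ne_zero hv hD, by rw [inv_div], ?_⟩
  rw [← h, inv_mul_cancel_left₀ hv]

lemma HasValue.div (hf : HasValue f x v) (hg : HasValue g x w) (hw : w ≠ 0) :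
    HasValue (f / g) x (v / w) := by
  rw [div_eq_mul_inv, div_eq_mul_inv]
  exact hf.mul (hg.inv hw)

lemma HasValue.eval₂ (hf : HasValue f x v) (q : L[X]) :
    HasValue (q.eval₂ RatFunc.C f) x (q.eval v) := by
  induction q using Polynomial.induction_on with
  | C a => simpa using hasValue_C a x
  | add p q hp hq => simpa using hp.add hq
  | monomial n a h =>
    simp only [eval₂_mul, eval₂_C, eval₂_pow, eval₂_X, eval_mul, eval_C, eval_pow, eval_X, pow_succ,
      ← mul_assoc] at h ⊢
    exact h.mul hf

/-- `HasValue` allows any fraction whose denominator does not vanish at `x`, which makes it stable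
under arithmetic. Passing to the reduced fraction is harmless, since its denominator divides every
other one. -/
lemma hasValue_iff : HasValue f x v ↔ f.denom.eval x ≠ 0 ∧ v = f.num.eval x / f.denom.eval x := by
  constructor
  · rintro ⟨N, D, hD, hf, h⟩
    have hD0 : D ≠ 0 := by rintro rfl; simp at hD
    have hd : f.denom.eval x ≠ 0 := fun h0 => hD (by
      obtain ⟨E, hE⟩ := hf ▸ RatFunc.denom_div_dvd N D
      rw [hE, eval_mul, h0, zero_mul])
    have e := congrArg (Polynomial.eval x) ((RatFunc.num_mul_eq_mul_denom_iff hD0).mpr hf)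
    simp only [eval_mul] at e
    refine ⟨hd, (eq_div_iff hd).mpr (mul_right_cancel₀ hD ?_)⟩
    linear_combination f.denom.eval x * h - e
  · rintro ⟨hd, rfl⟩
    nth_rw 1 [← RatFunc.num_div_denom f]
    exact hasValue_div _ hd

lemma HasValue.unique (hv : HasValue f x v) (hw : HasValue f x w) : v = w := by
  rw [hasValue_iff] at hv hw
  rw [hv.2, hw.2]

open Classical in
lemma hasValue_iff_evalP1_eq : HasValue f x v ↔ evalP1 f (x : OnePoint L) = (v : OnePoint L) := by
  rw [hasValue_iff]
  change _ ↔ (if f.denom.eval x = 0 then OnePoint.infty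
    else ((f.num.eval x / f.denom.eval x : L) : OnePoint L)) = _
  split_ifs with h
  · simp [h]
  · simp [h, eq_comm]

lemma HasValue.comp (hg : HasValue g x v) (hf : HasValue f v w) :
    HasValue (IterateField.comp f g) x w := by
  obtain ⟨hd, rfl⟩ := hasValue_iff.mp hf
  exact (hg.eval₂ f.num).div (hg.eval₂ f.denom) hd

/-- If `1 / g` vanishes at `x`, then `f ∘ g` takes at `x` the value of `f` at infinity. -/
lemma hasValue_comp_of_inv (hg0 : g ≠ 0) (hg : HasValue g⁻¹ x 0)
    (hf : f.num.natDegree ≤ f.denom.natDegree) :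
    HasValue (IterateField.comp f g) x
      (f.num.coeff f.denom.natDegree / f.denom.leadingCoeff) := by
  have hi := invertibleOfNonzero hg0
  -- Numerator and denominator are rewritten in `1 / g`: reflecting both at the degree of the
  -- denominator moves the coefficients that matter at infinity to the constant terms.
  have h1 := hg.eval₂ (reflect f.denom.natDegree f.num)
  have h2 := hg.eval₂ (reflect f.denom.natDegree f.denom)
  rw [← coeff_zero_eq_eval_zero, coeff_reflect, revAt_zero] at h1 h2
  have h := h1.div h2 (by simpa using f.denom_ne_zero)
  rw [← mul_div_mul_right _ _ (pow_ne_zero f.denom.natDegree hg0), ← invOf_eq_inv,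
    eval₂_reflect_mul_pow _ _ _ _ hf, eval₂_reflect_mul_pow _ _ _ _ le_rfl] at h
  exact h

lemma eq_of_hasValue [Infinite L] {p : L[X]} (hp : p ≠ 0)
    (h : ∀ x, p.eval x ≠ 0 → ∃ v, HasValue f x v ∧ HasValue g x v) : f = g := by
  have key : p * (f.num * g.denom - g.num * f.denom) = 0 := by
    refine Polynomial.funext fun x => ?_
    by_cases hx : p.eval x = 0
    · simp [hx]
    · obtain ⟨v, hf, hg⟩ := h x hx
      obtain ⟨hf', rfl⟩ := hasValue_iff.mp hf
      obtain ⟨hg', e⟩ := hasValue_iff.mp hg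
      rw [div_eq_div_iff hf' hg'] at e
      simp only [eval_mul, eval_sub, eval_zero]
      rw [e, sub_self, mul_zero]
  have := sub_eq_zero.mp ((mul_eq_zero.mp key).resolve_left hp)
  rw [← RatFunc.num_div_denom f, ← RatFunc.num_div_denom g,
    div_eq_div_iff (RatFunc.algebraMap_ne_zero f.denom_ne_zero)
      (RatFunc.algebraMap_ne_zero g.denom_ne_zero), ← map_mul, ← map_mul, this]

lemma eq_of_evalP1_eq [Infinite L] (h : ∀ x : L, evalP1 f (x : OnePoint L) = evalP1 g x) :
    f = g := by
  refine eq_of_hasValue f.denom_ne_zero fun x hx => ?_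
  have hf : HasValue f x (f.num.eval x / f.denom.eval x) := hasValue_iff.mpr ⟨hx, rfl⟩
  exact ⟨_, hf, hasValue_iff_evalP1_eq.mpr (h x ▸ hasValue_iff_evalP1_eq.mp hf)⟩

lemma exists_eq_C_mul_num_denom {N D : L[X]} (hND : IsCoprime N D) (hD : D ≠ 0) :
    ∃ c ≠ 0,
      N = C c * (algebraMap L[X] (RatFunc L) N / algebraMap L[X] (RatFunc L) D).num ∧
      D = C c * (algebraMap L[X] (RatFunc L) N / algebraMap L[X] (RatFunc L) D).denom := by
  set f := algebraMap L[X] (RatFunc L) N / algebraMap L[X] (RatFunc L) D with hf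
  have e := (RatFunc.num_mul_eq_mul_denom_iff hD).mpr hf
  have h1 : D ∣ f.denom := hND.symm.dvd_of_dvd_mul_left (e ▸ dvd_mul_left _ _)
  obtain ⟨u, hu⟩ := associated_of_dvd_dvd (RatFunc.denom_div_dvd N D) h1
  obtain ⟨c, hc, hcu⟩ := isUnit_iff.mp u.isUnit
  rw [← hf] at hu
  have hD' : D = C c * f.denom := by rw [hcu, mul_comm, hu]
  refine ⟨c, hc.ne_zero, mul_right_cancel₀ f.denom_ne_zero ?_, hD'⟩
  rw [← e]
  nth_rw 1 [hD']
  ring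

lemma evalP1_infty_eq (hf : f.num.natDegree ≤ f.denom.natDegree) :
    evalP1 f OnePoint.infty =
      ((f.num.coeff f.denom.natDegree / f.denom.leadingCoeff : L) : OnePoint L) :=
  if_neg (not_lt.mpr hf)

end HasValue

/-! ### Functions over `K`, and an obstruction to membership in `B(K)` -/

section BaseChange

variable {K L : Type*} [Field K] [Field L] [Algebra K L]

lemma baseChange_div (N D : K[X]) :
    baseChange K L (algebraMap K[X] (RatFunc K) N / algebraMap K[X] (RatFunc K) D) =
      algebraMap L[X] (RatFunc L) (N.map (algebraMap K L)) /
        algebraMap L[X] (RatFunc L) (D.map (algebraMap K L)) := by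
  rw [baseChange, RatFunc.coe_mapRingHom_eq_coe_map, RatFunc.map_apply_div]
  rfl

lemma baseChange_eq (g : RatFunc K) :
    baseChange K L g = algebraMap L[X] (RatFunc L) (g.num.map (algebraMap K L)) /
        algebraMap L[X] (RatFunc L) (g.denom.map (algebraMap K L)) := by
  rw [← baseChange_div, RatFunc.num_div_denom]

lemma hasValue_baseChange {g : RatFunc K} {x : K} (hx : g.denom.eval x ≠ 0) :
    HasValue (baseChange K L g) (algebraMap K L x)
      (algebraMap K L (g.num.eval x / g.denom.eval x)) := by
  have := hasValue_div (g.num.map (algebraMap K L)) (D := g.denom.map (algebraMap K L))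
    (x := algebraMap K L x) (by simpa [eval_map_algebraMap, aeval_algebraMap_apply] using hx)
  rw [baseChange_eq]
  simpa [eval_map_algebraMap, aeval_algebraMap_apply] using this

lemma comp_X_pow_eq (N D : L[X]) {t : ℕ} (ht : 0 < t) (hD : D ≠ 0) :
    comp (algebraMap L[X] (RatFunc L) N / algebraMap L[X] (RatFunc L) D) (RatFunc.X ^ t) =
      algebraMap L[X] (RatFunc L) (expand L t N) / algebraMap L[X] (RatFunc L) (expand L t D) := by
  have he (q : L[X]) :
      q.eval₂ RatFunc.C (RatFunc.X ^ t) = algebraMap L[X] (RatFunc L) (expand L t q) := by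
    rw [expand_eq_sum, ← eval₂_eq_sum, hom_eval₂]
    simp
  set f := algebraMap L[X] (RatFunc L) N / algebraMap L[X] (RatFunc L) D with hf
  have e := (RatFunc.num_mul_eq_mul_denom_iff hD).mpr hf
  have hne {q : L[X]} (hq : q ≠ 0) : algebraMap L[X] (RatFunc L) (expand L t q) ≠ 0 :=
    RatFunc.algebraMap_ne_zero ((expand_ne_zero ht).mpr hq)
  rw [comp, RatFunc.eval, he, he, div_eq_div_iff (hne f.denom_ne_zero) (hne hD), ← map_mul,
    ← map_mul, ← map_mul, ← map_mul, e]

/-- A polynomial is a power of the variable times one that does not vanish at `0`. -/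
lemma exists_eq_X_pow_mul {p : K[X]} (hp : p ≠ 0) : ∃ n q, p = X ^ n * q ∧ q.eval 0 ≠ 0 := by
  obtain ⟨q, hq, hd⟩ := exists_eq_pow_rootMultiplicity_mul_and_not_dvd p hp 0
  refine ⟨_, q, by simpa using hq, fun h => hd ?_⟩
  exact dvd_iff_isRoot.mpr h

/-- If `a x ^ k g(x ^ t)` with `g` over `K` and `a ^ t` in `K` is finite at `0`, then its value
there lies in `K`. -/
lemma mem_range_of_hasValue_zero {a : L} {k t : ℕ} {g : RatFunc K} (ht : 0 < t)
    (hkt : k.Coprime t) (ha : a ^ t ∈ Set.range (algebraMap K L)) {s : L}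
    (h : HasValue (RatFunc.C a * RatFunc.X ^ k * comp (baseChange K L g) (RatFunc.X ^ t)) 0 s) :
    s ∈ Set.range (algebraMap K L) := by
  obtain ⟨N, D, hD, hND, hs⟩ := h
  have hgd : g.denom.map (algebraMap K L) ≠ 0 := by simpa using g.denom_ne_zero
  rw [baseChange_eq, comp_X_pow_eq _ _ ht hgd] at hND
  have hne : algebraMap L[X] (RatFunc L) (expand L t (g.denom.map (algebraMap K L))) ≠ 0 :=
    RatFunc.algebraMap_ne_zero ((expand_ne_zero ht).mpr hgd)
  have hD' := algebraMap_ne_zero_of_eval_ne_zero hD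
  have e : C a * X ^ k * expand L t (g.num.map (algebraMap K L)) * D =
      N * expand L t (g.denom.map (algebraMap K L)) := by
    apply RatFunc.algebraMap_injective L
    rw [mul_div_assoc', div_eq_div_iff hne hD'] at hND
    simpa using hND
  have hs' {p : K[X]} (n : ℕ) {q : K[X]} (hp : p = X ^ n * q) :
      expand L t (p.map (algebraMap K L)) =
        X ^ (t * n) * expand L t (q.map (algebraMap K L)) := by
    rw [hp]; simp [pow_mul]
  have he (q : K[X]) : (expand L t (q.map (algebraMap K L))).eval 0 = algebraMap K L (q.eval 0) := by
    rw [expand_eval, zero_pow ht.ne', ← map_zero (algebraMap K L), eval_map_algebraMap,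
      aeval_algebraMap_apply]
    simp
  have hzero : N.eval 0 = 0 → s ∈ Set.range (algebraMap K L) := fun h0 =>
    ⟨0, by rw [h0] at hs; simpa using ((mul_eq_zero.mp hs).resolve_right hD).symm⟩
  obtain ⟨j, G, hG, hG0⟩ := exists_eq_X_pow_mul g.denom_ne_zero
  obtain hn | hn := eq_or_ne g.num 0
  · rw [hn] at e
    have : N = 0 := by simpa [hgd, (expand_ne_zero ht).mpr hgd] using e
    exact hzero (by simp [this])
  obtain ⟨i, H, hH, hH0⟩ := exists_eq_X_pow_mul hn
  rw [hs' j hG, hs' i hH] at e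
  have hmap0 {q : K[X]} (hq : q.eval 0 ≠ 0) : algebraMap K L (q.eval 0) ≠ 0 := by simpa using hq
  -- The order at `0` is `k + t * i - t * j` when `a ≠ 0`. If positive, the value is `0`. If zero,
  -- `t` divides `k`, so `t = 1` and `a` lies in `K`. If negative, finiteness at `0` forces `a = 0`.
  rcases lt_trichotomy (t * j) (k + t * i) with hlt | heq | hlt
  · obtain ⟨m, hm⟩ := Nat.exists_eq_add_of_lt hlt
    have e' : C a * X ^ (m + 1) * expand L t (H.map (algebraMap K L)) * D =
        N * expand L t (G.map (algebraMap K L)) := by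
      refine mul_left_cancel₀ (pow_ne_zero (t * j) X_ne_zero) ?_
      have : (X : L[X]) ^ k * X ^ (t * i) = X ^ (t * j) * X ^ (m + 1) := by
        rw [← pow_add, ← pow_add, hm, add_assoc]
      linear_combination e - C a * expand L t (H.map (algebraMap K L)) * D * this
    have := congrArg (Polynomial.eval 0) e'
    simp only [eval_mul, he, eval_pow, eval_X, eval_C] at this
    simp [hG0] at this
    exact hzero this
  · have htk : t ∣ k := (Nat.dvd_add_left (dvd_mul_right t i)).mp (heq ▸ dvd_mul_right t j)
    obtain rfl : t = 1 := Nat.eq_one_of_dvd_coprimes hkt htk dvd_rfl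
    obtain ⟨b, hb⟩ := ha
    rw [pow_one] at hb
    have e' : C a * expand L 1 (H.map (algebraMap K L)) * D =
        N * expand L 1 (G.map (algebraMap K L)) := by
      refine mul_left_cancel₀ (pow_ne_zero (1 * j) X_ne_zero) ?_
      rw [heq, pow_add] at e ⊢
      linear_combination e
    have := congrArg (Polynomial.eval 0) e'
    simp only [eval_mul, he, eval_C, ← hs, ← hb] at this
    refine ⟨b * H.eval 0 / G.eval 0, ?_⟩
    rw [map_div₀, map_mul, div_eq_iff (hmap0 hG0)]
    exact mul_right_cancel₀ hD (by linear_combination this)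
  · obtain ⟨m, hm⟩ := Nat.exists_eq_add_of_lt hlt
    have e' : C a * expand L t (H.map (algebraMap K L)) * D =
        N * (X ^ (m + 1) * expand L t (G.map (algebraMap K L))) := by
      refine mul_left_cancel₀ (pow_ne_zero (k + t * i) X_ne_zero) ?_
      have : (X : L[X]) ^ (t * j) = X ^ (k + t * i) * X ^ (m + 1) := by
        rw [← pow_add, hm, add_assoc]
      rw [this, pow_add] at e
      rw [pow_add]
      linear_combination e
    have := congrArg (Polynomial.eval 0) e'
    simp only [eval_mul, he, eval_pow, eval_X, eval_C] at this
    simp [hH0, hD] at this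
    subst this
    have hN : N = 0 := by
      have hE : expand L t (G.map (algebraMap K L)) ≠ 0 := by
        intro h0; apply hmap0 hG0; rw [← he, h0, eval_zero]
      simpa [hE] using e
    exact hzero (by simp [hN])

/-- A fractional linear transformation over `K` sends elements outside `K` to such elements. -/
lemma exists_hasValue_fracLin (M : Matrix.GeneralLinearGroup (Fin 2) K) {w : L}
    (hw : w ∉ Set.range (algebraMap K L)) :
    ∃ s ∉ Set.range (algebraMap K L), HasValue (fracLin K L M) w s := by
  have hdet : M 0 0 * M 1 1 - M 0 1 * M 1 0 ≠ 0 := by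
    rw [← Matrix.det_fin_two]
    exact M.det_ne_zero
  have hlin {a b : K} (h : algebraMap K L a * w + algebraMap K L b = 0) : a = 0 ∧ b = 0 := by
    obtain rfl | ha := eq_or_ne a 0
    · simpa using h
    · refine absurd ⟨-b / a, ?_⟩ hw
      have : algebraMap K L a ≠ 0 := by simpa using ha
      rw [map_div₀, map_neg, div_eq_iff this]
      linear_combination -h
  have hden : algebraMap K L (M 1 0) * w + algebraMap K L (M 1 1) ≠ 0 := by
    intro h
    obtain ⟨h1, h2⟩ := hlin h
    simp [h1, h2] at hdet
  refine ⟨_, ?_, (((hasValue_C _ _).mul (hasValue_X _)).add (hasValue_C _ _)).div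
    (((hasValue_C _ _).mul (hasValue_X _)).add (hasValue_C _ _)) hden⟩
  rintro ⟨s, hs⟩
  rw [eq_div_iff hden] at hs
  obtain ⟨h1, h2⟩ := hlin (a := M 0 0 - s * M 1 0) (b := M 0 1 - s * M 1 1) (by
    simp only [map_sub, map_mul]
    linear_combination -hs)
  exact hdet (by linear_combination M 1 1 * h1 - M 1 0 * h2)

/-- A rational function that takes no `K`-rational point of the projective line to a
`K`-rational point is not in `B(K)`. -/
lemma notMem_setB {f : RatFunc L} (hf : f.num.natDegree ≤ f.denom.natDegree)
    (hinf : f.num.coeff f.denom.natDegree / f.denom.leadingCoeff ∉ Set.range (algebraMap K L))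
    (hfin : ∀ x : K, ∃ v ∉ Set.range (algebraMap K L), HasValue f (algebraMap K L x) v) :
    f ∉ setB K L := by
  rintro ⟨a, k, t, g, -, ht, hkt, ha, M, hM⟩
  have hdet : M 0 0 * M 1 1 - M 0 1 * M 1 0 ≠ 0 := by
    rw [← Matrix.det_fin_two]
    exact M.det_ne_zero
  have hlin (b c : K) : HasValue (RatFunc.C (algebraMap K L b) * RatFunc.X +
      RatFunc.C (algebraMap K L c)) 0 (algebraMap K L c) := by
    simpa using ((hasValue_C (algebraMap K L b) 0).mul (hasValue_X 0)).add
      (hasValue_C (algebraMap K L c) 0)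
  obtain ⟨w, hw, hwv⟩ : ∃ w ∉ Set.range (algebraMap K L),
      HasValue (comp f (fracLin K L M)) 0 w := by
    -- The point `ℓ(0)` is `M 0 1 / M 1 1`, or `∞` when `M 1 1 = 0`; in either case it is
    -- `K`-rational.
    by_cases hd : M 1 1 = 0
    · have hb : M 0 1 ≠ 0 := by rintro h; simp [h, hd] at hdet
      have hc : M 1 0 ≠ 0 := by rintro h; simp [h, hd] at hdet
      have hv := (hlin (M 1 0) (M 1 1)).div (hlin (M 0 0) (M 0 1)) (by simpa using hb)
      rw [← inv_div] at hv
      refine ⟨_, hinf, hasValue_comp_of_inv (g := fracLin K L M) ?_ (by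
        simpa [hd, fracLin] using hv) hf⟩
      refine div_ne_zero (fun h0 => ?_) ?_
      · have := (hlin (M 0 0) (M 0 1)).unique (w := 0) (by
          rw [h0]; simpa using hasValue_C (0 : L) 0)
        simp [hb] at this
      · simp [hd, hc, RatFunc.X_ne_zero]
    · obtain ⟨v, hv, hfv⟩ := hfin (M 0 1 / M 1 1)
      refine ⟨v, hv, HasValue.comp ?_ hfv⟩
      rw [map_div₀]
      exact (hlin _ _).div (hlin _ _) (by simpa using hd)
  obtain ⟨s, hs, hsv⟩ := exists_hasValue_fracLin M⁻¹ hw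
  exact hs (mem_range_of_hasValue_zero ht hkt ha (hM ▸ hwv.comp hsv))

lemma notMem_definedOver [Infinite K] {f : RatFunc L}
    (hfin : ∀ x : K, ∃ v ∉ Set.range (algebraMap K L), HasValue f (algebraMap K L x) v) :
    f ∉ definedOver K L := by
  rintro ⟨g, rfl⟩
  obtain ⟨x, hx⟩ : ∃ x, g.denom.eval x ≠ 0 := by
    by_contra! h
    exact g.denom_ne_zero (Polynomial.funext fun x => by simpa using h x)
  obtain ⟨v, hv, hgv⟩ := hfin x
  exact hv ⟨_, (hasValue_baseChange hx).unique hgv⟩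

end BaseChange

end IterateField

namespace IterateField

open Polynomial WeierstrassCurve

/-! ### Values on `ℙ¹` from homogeneous coordinates -/

section Evaluation

variable {L : Type*} [Field L]

open Classical in
lemma evalP1_div_of_isCoprime {N D : L[X]} (h : IsCoprime N D) (hD : D ≠ 0) (x : L) :
    evalP1 (algebraMap L[X] (RatFunc L) N / algebraMap L[X] (RatFunc L) D) (x : OnePoint L) =
      if D.eval x = 0 then OnePoint.infty else ((N.eval x / D.eval x : L) : OnePoint L) := by
  obtain ⟨c, hc, hN, hD'⟩ := exists_eq_C_mul_num_denom h hD
  generalize algebraMap L[X] (RatFunc L) N / algebraMap L[X] (RatFunc L) D = f at *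
  change (if f.denom.eval x = 0 then OnePoint.infty
    else ((f.num.eval x / f.denom.eval x : L) : OnePoint L)) = _
  simp only [hN, hD', eval_mul, eval_C, mul_eq_zero, hc, false_or, mul_div_mul_left _ _ hc]

open Classical in
lemma xCoord_eq {W : Affine L} {P : W.Point} {a b : L} (hab : a ≠ 0 ∨ b ≠ 0)
    (h : P.xRep 1 * a = P.xRep 0 * b) :
    xCoord P = if b = 0 then OnePoint.infty else ((a / b : L) : OnePoint L) := by
  obtain ⟨c, hc, rfl, rfl⟩ := P.exists_eq_mul_xRep hab h
  rcases P with _ | ⟨x, y, hxy⟩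
  · simp [← Affine.Point.zero_def]; rfl
  · simp [hc, xCoord]

end Evaluation

/-! ### Translation by a point of order two -/

section TwoTorsion

variable {L : Type*} [Field L] [DecidableEq L] [CharZero L] {W : Affine L}

lemma exists_eq_some_zero (ha₁ : W.a₁ = 0) (ha₃ : W.a₃ = 0) {Q : W.Point}
    (hQ : addOrderOf Q = 2) : ∃ r h, Q = .some r 0 h := by
  have h2 : Q + Q = 0 := by rw [← two_nsmul, ← hQ, addOrderOf_nsmul_eq_zero]
  rcases Q with _ | ⟨r, y, h⟩
  · rw [← Affine.Point.zero_def, addOrderOf_zero] at hQ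
    omega
  · have e := eq_neg_of_add_eq_zero_left h2
    rw [Affine.Point.neg_some, Affine.Point.some.injEq, Affine.negY, ha₁, ha₃] at e
    have hy : y = 0 := by
      have : 2 * y = 0 := by linear_combination e.2
      simpa using this
    subst hy
    exact ⟨r, h, rfl⟩

/-- Since `(r, 0)` is its own negative, sum and difference coincide and the quadratic form has a
double root. Its root, half the sum over the denominator, is the Möbius map after cancelling `a - r
* b`. -/
lemma xRep_add_two_torsion (ha₁ : W.a₁ = 0) (ha₃ : W.a₃ = 0) (P : W.Point) {r : L}
    (h : W.Nonsingular r 0) :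
    (P + .some r 0 h).xRep 1 *
        (r * P.xRep 0 + (2 * r ^ 2 + 2 * W.a₂ * r + W.a₄) * P.xRep 1) =
      (P + .some r 0 h).xRep 0 * (P.xRep 0 - r * P.xRep 1) := by
  obtain ⟨c, hc, -, hY, hZ⟩ := exists_addSub_eq ha₁ ha₃ P h
  have hn : -Affine.Point.some r 0 h = Affine.Point.some r 0 h := by
    rw [Affine.Point.neg_some, Affine.Point.some.injEq, Affine.negY, ha₁, ha₃]
    simp
  have e := (Affine.equation_iff ..).mp h.1
  simp only [ha₁, ha₃, zero_mul, add_zero, ne_eq, OfNat.ofNat_ne_zero, not_false_eq_true, zero_pow]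
    at e
  rw [sub_eq_add_neg, hn] at hY hZ
  simp only [addSubY, addSubZ] at hY hZ
  generalize P.xRep 0 = a at *
  generalize P.xRep 1 = b at *
  rcases (P + Affine.Point.some r 0 h).xRep_eq_or with ⟨h0, h1⟩ | h1
  · rw [h1, mul_zero, mul_zero] at hZ
    rw [h0, h1]
    linear_combination -(pow_eq_zero_iff two_ne_zero).mp hZ
  · rw [h1] at hY hZ ⊢
    have hne : 2 * (a - r * b) ≠ 0 := by
      intro h0
      have h0' : a - r * b = 0 := by simpa using h0
      apply hc
      linear_combination -hZ + (a - r * b) * h0'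
    refine mul_left_cancel₀ hne ?_
    linear_combination hY - 2 * (P + Affine.Point.some r 0 h).xRep 0 * hZ + 4 * b ^ 2 * e

end TwoTorsion

/-- The powers `1, r, r ^ 2` of a root of an irreducible cubic are linearly independent. -/
lemma eq_zero_of_quadratic {K L : Type*} [Field K] [Field L] [Algebra K L] {p : K[X]}
    (hp : Irreducible p) (hdeg : p.natDegree = 3) {r : L} (hr : aeval r p = 0) {a b c : K}
    (h : algebraMap K L a * r ^ 2 + algebraMap K L b * r + algebraMap K L c = 0) :
    a = 0 ∧ b = 0 ∧ c = 0 := by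
  set q := C a * X ^ 2 + C b * X + C c with hq
  have hqr : aeval r q = 0 := by simpa [hq] using h
  have hdvd : p ∣ q := by
    by_contra hnd
    obtain ⟨u, v, huv⟩ := hp.coprime_iff_not_dvd.mpr hnd
    simpa [hr, hqr] using congrArg (aeval r) huv
  have hq0 : q = 0 := by
    refine eq_zero_of_dvd_of_natDegree_lt hdvd ?_
    rw [hdeg]
    exact (natDegree_quadratic_le (a := a) (b := b) (c := c)).trans_lt (by norm_num)
  refine ⟨?_, ?_, ?_⟩
  · simpa [hq] using congrArg (coeff · 2) hq0
  · simpa [hq, coeff_X, coeff_C] using congrArg (coeff · 1) hq0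
  · simpa [hq] using congrArg (coeff · 0) hq0

/-! ### The function induced by `P ↦ nP + (r, 0)` -/

section Lattes

variable {K L : Type*} [Field K] [Field L] [Algebra K L]

/-- The numerator of the `x`-coordinate of `n P + (r, 0)`, in terms of `x(n P) = A / B`. -/
noncomputable def lattesNum (E : WeierstrassCurve K) (r : L) (A B : K[X]) : L[X] :=
  C r * A.map (algebraMap K L) +
    C (2 * r ^ 2 + 2 * (E.baseChange L).a₂ * r + (E.baseChange L).a₄) * B.map (algebraMap K L)

/-- The denominator of the `x`-coordinate of `n P + (r, 0)`, in terms of `x(n P) = A / B`. -/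
noncomputable def lattesDenom (r : L) (A B : K[X]) : L[X] :=
  A.map (algebraMap K L) - C r * B.map (algebraMap K L)

/-- The rational function giving the `x`-coordinate of `n P + (r, 0)`, in terms of
`x(n P) = A / B`. -/
noncomputable def lattes (E : WeierstrassCurve K) (r : L) (A B : K[X]) : RatFunc L :=
  algebraMap L[X] (RatFunc L) (lattesNum E r A B) / algebraMap L[X] (RatFunc L) (lattesDenom r A B)

variable {E : WeierstrassCurve K} {r : L} {A B : K[X]}

lemma natDegree_lattesDenom (h : B.degree < A.degree) :
    lattesDenom r A B ≠ 0 ∧ (lattesDenom r A B).natDegree = A.natDegree ∧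
      (lattesDenom r A B).leadingCoeff = algebraMap K L A.leadingCoeff := by
  have hlt : (C r * B.map (algebraMap K L)).degree < (A.map (algebraMap K L)).degree := by
    refine (degree_mul_le _ _).trans_lt ((add_le_add_left degree_C_le _).trans_lt ?_)
    simpa using h
  have hA : A ≠ 0 := by rintro rfl; simp at h
  have hdeg : (lattesDenom r A B).degree = A.degree := by
    rw [lattesDenom, degree_sub_eq_left_of_degree_lt hlt, degree_map]
  refine ⟨fun h0 => ?_, natDegree_eq_of_degree_eq hdeg, ?_⟩
  · rw [h0, degree_zero] at hdeg
    exact hA (degree_eq_bot.mp hdeg.symm)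
  · rw [lattesDenom, leadingCoeff_sub_of_degree_lt hlt, leadingCoeff_map]

lemma natDegree_lattesNum (h : B.degree < A.degree) :
    (lattesNum E r A B).natDegree ≤ A.natDegree ∧
      (lattesNum E r A B).coeff A.natDegree = r * algebraMap K L A.leadingCoeff := by
  constructor
  · refine natDegree_add_le_of_degree_le ((natDegree_C_mul_le _ _).trans ?_)
      ((natDegree_C_mul_le _ _).trans ?_)
    · simp
    · simpa using natDegree_le_natDegree h.le
  · have hB : B.coeff A.natDegree = 0 := by
      apply coeff_eq_zero_of_degree_lt
      rwa [← degree_eq_natDegree (by rintro rfl; simp at h)]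
    simp only [lattesNum, coeff_add, coeff_C_mul, coeff_map, hB, map_zero, mul_zero, add_zero,
      leadingCoeff]

/-- The Möbius map has determinant `-p'(r)`, so `A` and `B` are recovered linearly from the new pair
when `p'(r) ≠ 0`. -/
lemma isCoprime_lattes (hAB : IsCoprime A B)
    (hr : 3 * r ^ 2 + 2 * (E.baseChange L).a₂ * r + (E.baseChange L).a₄ ≠ 0) :
    IsCoprime (lattesNum E r A B) (lattesDenom r A B) := by
  obtain ⟨u, v, huv⟩ := hAB.map (mapRingHom (algebraMap K L))
  simp only [coe_mapRingHom] at huv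
  have hC : C (3 * r ^ 2 + 2 * (E.baseChange L).a₂ * r + (E.baseChange L).a₄)⁻¹ *
      (C r * C r + C (2 * r ^ 2 + 2 * (E.baseChange L).a₂ * r + (E.baseChange L).a₄)) = 1 := by
    rw [← C_mul, ← C_add, ← C_mul, ← C_1]
    congr 1
    rw [inv_mul_eq_one₀ hr]
    ring
  simp only [lattesNum, lattesDenom]
  generalize C (2 * r ^ 2 + 2 * (E.baseChange L).a₂ * r + (E.baseChange L).a₄) = s at *
  generalize C (3 * r ^ 2 + 2 * (E.baseChange L).a₂ * r + (E.baseChange L).a₄)⁻¹ = t at *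
  refine ⟨t * (u * C r + v), t * (u * s - v * C r), ?_⟩
  linear_combination t * (C r * C r + s) * huv + hC

lemma lattes_at_infty (hAB : IsCoprime A B)
    (hr : 3 * r ^ 2 + 2 * (E.baseChange L).a₂ * r + (E.baseChange L).a₄ ≠ 0)
    (h : B.degree < A.degree) :
    (lattes E r A B).num.natDegree ≤ (lattes E r A B).denom.natDegree ∧
      (lattes E r A B).num.coeff (lattes E r A B).denom.natDegree /
        (lattes E r A B).denom.leadingCoeff = r := by
  obtain ⟨hD, hdeg, hlc⟩ := natDegree_lattesDenom (r := r) h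
  obtain ⟨hdegN, hcN⟩ := natDegree_lattesNum (E := E) (r := r) h
  obtain ⟨c, hc, hcn, hcd⟩ := exists_eq_C_mul_num_denom (isCoprime_lattes hAB hr) hD
  rw [← lattes] at hcn hcd
  have hA : algebraMap K L A.leadingCoeff ≠ 0 := by
    have : A ≠ 0 := by rintro rfl; simp at h
    simpa using this
  rw [hcd, natDegree_C_mul hc] at hdeg
  rw [hcd, leadingCoeff_mul, leadingCoeff_C] at hlc
  rw [hcn, natDegree_C_mul hc] at hdegN
  rw [hcn, coeff_C_mul] at hcN
  rw [hdeg]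
  refine ⟨hdegN, ?_⟩
  rw [← mul_div_mul_left _ _ hc, hcN, hlc, mul_div_cancel_right₀ _ hA]

lemma exists_hasValue_lattes {p : K[X]} (hp : Irreducible p) (hdeg : p.natDegree = 3)
    (hr : aeval r p = 0) [CharZero K] (hAB : IsCoprime A B) (x : K) :
    ∃ v ∉ Set.range (algebraMap K L), HasValue (lattes E r A B) (algebraMap K L x) v := by
  have hD : (lattesDenom r A B).eval (algebraMap K L x) =
      algebraMap K L (A.eval x) - r * algebraMap K L (B.eval x) := by
    simp [lattesDenom, eval_map_algebraMap, aeval_algebraMap_apply]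
  have hN : (lattesNum E r A B).eval (algebraMap K L x) = r * algebraMap K L (A.eval x) +
      (2 * r ^ 2 + 2 * (E.baseChange L).a₂ * r + (E.baseChange L).a₄) *
        algebraMap K L (B.eval x) := by
    simp [lattesNum, eval_map_algebraMap, aeval_algebraMap_apply]
  have h0 : ¬(A.eval x = 0 ∧ B.eval x = 0) := by
    obtain ⟨u, v, huv⟩ := hAB
    rintro ⟨h1, h2⟩
    simpa [h1, h2] using congrArg (Polynomial.eval x) huv
  have hD0 : (lattesDenom r A B).eval (algebraMap K L x) ≠ 0 := by
    rw [hD]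
    intro h
    obtain ⟨-, h1, h2⟩ := eq_zero_of_quadratic hp hdeg hr (a := 0) (b := -B.eval x)
      (c := A.eval x) (by simp only [map_zero, map_neg]; linear_combination h)
    exact h0 ⟨h2, by simpa using h1⟩
  refine ⟨_, ?_, hasValue_div _ hD0⟩
  rintro ⟨s, hs⟩
  rw [eq_div_iff hD0, hD, hN] at hs
  -- A rational value `s` gives a quadratic relation for `r`. Its coefficient of `r²` is `2 B(x)`,
  -- and once `B(x) = 0` its coefficient of `r` is `A(x)`; both cannot vanish.
  obtain ⟨h1, h2, -⟩ := eq_zero_of_quadratic hp hdeg hr (a := 2 * B.eval x)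
    (b := A.eval x + 2 * E.a₂ * B.eval x + s * B.eval x)
    (c := E.a₄ * B.eval x - s * A.eval x) (by
      simp only [map_add, map_sub, map_mul, map_ofNat]
      change _ = r * _ + (2 * r ^ 2 + 2 * algebraMap K L E.a₂ * r + algebraMap K L E.a₄) * _ at hs
      linear_combination -hs)
  have hB : B.eval x = 0 := by simpa using h1
  exact h0 ⟨by simpa [hB] using h2, hB⟩

lemma descendsTo_lattes [DecidableEq L] [CharZero L] [IsAlgClosed L] (ha₁ : E.a₁ = 0) (ha₃ : E.a₃ = 0) {n : ℕ}
    (hAB : IsMulX (K := L) E n A B) (h : (E.baseChange L).toAffine.Nonsingular r 0) :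
    DescendsTo (fun P => n • P + .some r 0 h) (lattes E r A B) := by
  have ha₁' : (E.baseChange L).toAffine.a₁ = 0 := by simp [ha₁]
  have ha₃' : (E.baseChange L).toAffine.a₃ = 0 := by simp [ha₃]
  have hr : 3 * r ^ 2 + 2 * (E.baseChange L).a₂ * r + (E.baseChange L).a₄ ≠ 0 := by
    have := ((Affine.nonsingular_iff' ..).mp h).2
    rw [ha₁', ha₃'] at this
    intro h0
    rcases this with h1 | h1
    · exact h1 (by linear_combination -h0)
    · simp at h1
  have hco := isCoprime_lattes hAB.isCoprime hr
  rintro (_ | ⟨x, y, hxy⟩)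
  · obtain ⟨h1, h2⟩ := lattes_at_infty hAB.isCoprime hr hAB.degree_lt
    rw [← Affine.Point.zero_def]
    change xCoord (n • 0 + Affine.Point.some r 0 h) = evalP1 _ OnePoint.infty
    rw [smul_zero, zero_add, evalP1_infty_eq h1, h2]
    rfl
  · change xCoord (n • Affine.Point.some x y hxy + _) = evalP1 (lattes E r A B) (x : OnePoint L)
    rw [lattes, evalP1_div_of_isCoprime hco (natDegree_lattesDenom hAB.degree_lt).1 x]
    refine xCoord_eq (by simpa using aeval_ne_zero_or_of_isCoprime hco x) ?_
    obtain ⟨c, -, hA, hB⟩ := hAB.exists_eq hxy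
    have := xRep_add_two_torsion ha₁' ha₃' (n • Affine.Point.some x y hxy) h
    simp only [lattesNum, lattesDenom, eval_add, eval_sub, eval_mul, eval_C, eval_map_algebraMap,
      hA, hB]
    linear_combination c * this

lemma DescendsTo.eq [IsAlgClosed L] [E.IsElliptic] (ha₁ : E.a₁ = 0) (ha₃ : E.a₃ = 0)
    {Ψ : (E.baseChange L).toAffine.Point → (E.baseChange L).toAffine.Point} {f g : RatFunc L}
    (hf : DescendsTo Ψ f) (hg : DescendsTo Ψ g) : f = g := by
  have := IsAlgClosed.instInfinite (K := L)
  refine eq_of_evalP1_eq fun x => ?_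
  have : (E.baseChange L).toAffine.IsElliptic :=
    inferInstanceAs (E.map (algebraMap K L)).IsElliptic
  obtain ⟨y, hxy⟩ := exists_nonsingular (E.baseChange L).toAffine (by simp [ha₁]) (by simp [ha₃]) x
  exact (hf (.some x y hxy)).symm.trans (hg (.some x y hxy))

/-- If a self-map `Ψ` of the curve has `Ψ ∘ Ψ = [n]` and descends to `f`, then `f ∘ f` is
defined over the base field. -/
lemma DescendsTo.mem_setA_two [DecidableEq L] [IsAlgClosed L] [E.IsElliptic] (ha₁ : E.a₁ = 0) (ha₃ : E.a₃ = 0)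
    {Ψ : (E.baseChange L).toAffine.Point → (E.baseChange L).toAffine.Point} {f : RatFunc L}
    (hf : DescendsTo Ψ f) {n : ℕ} (hΨ : ∀ P, Ψ (Ψ P) = n • P)
    {P₀ : (E.baseChange L).toAffine.Point} (hP₀ : n • P₀ ≠ 0) :
    f ∈ setA K L 2 := by
  obtain ⟨A, B, hAB⟩ := exists_isMulX L (W := E) ha₁ ha₃ n
  have := IsAlgClosed.instInfinite (K := L)
  have : (E.baseChange L).toAffine.IsElliptic :=
    inferInstanceAs (E.map (algebraMap K L)).IsElliptic
  -- If `B = 0`, then `[n]` kills every point; `P₀` rules this out.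
  have hB : B.map (algebraMap K L) ≠ 0 := by
    rw [Polynomial.map_ne_zero_iff (algebraMap K L).injective]
    rintro rfl
    apply hP₀
    rcases P₀ with _ | ⟨x, y, hxy⟩
    · exact smul_zero n
    · have h1 := hAB.xRep_mul hxy
      rw [map_zero, mul_zero, mul_eq_zero] at h1
      replace h1 := h1.resolve_right
        ((aeval_ne_zero_or_of_isCoprime hAB.isCoprime x).resolve_right (by simp))
      generalize n • Affine.Point.some x y hxy = R at *
      rcases R with _ | _
      · rfl
      · simp at h1
  refine ⟨algebraMap K[X] (RatFunc K) A / algebraMap K[X] (RatFunc K) B, ?_⟩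
  have hi : iter f 2 = comp f f := by simp [iter, comp]
  rw [baseChange_div, hi]
  -- The two functions are compared away from the poles of `f` and the zeros of `B`, where every
  -- value involved is finite.
  refine eq_of_hasValue (mul_ne_zero hB f.denom_ne_zero) fun x hx => ?_
  rw [eval_mul, mul_ne_zero_iff] at hx
  obtain ⟨y, hxy⟩ := exists_nonsingular (E.baseChange L).toAffine (by simp [ha₁]) (by simp [ha₃]) x
  refine ⟨_, hasValue_div _ hx.1, ?_⟩
  have h1 := hf (.some x y hxy)
  have h2 := hf (Ψ (.some x y hxy))
  have hv : HasValue f x (f.num.eval x / f.denom.eval x) := hasValue_iff.mpr ⟨hx.2, rfl⟩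
  refine hv.comp (hasValue_iff_evalP1_eq.mpr ?_)
  rw [← hasValue_iff_evalP1_eq.mp hv]
  change _ = evalP1 f (x : OnePoint L) at h1
  rw [← h1, ← h2, hΨ, xCoord_eq (by simpa using Or.inr hx.1) (hAB.xRep_mul hxy), if_neg]
  · simp
  · simpa using hx.1

end Lattes

end IterateField

/-! ### The proposition -/

theorem mainTheorem6 [DecidableEq (AlgebraicClosure ℚ)]
    (E : WeierstrassCurve ℚ) [E.IsElliptic] (p : Polynomial ℚ)
    (ha₁ : E.a₁ = 0) (ha₃ : E.a₃ = 0)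
    (hE : p = Polynomial.X ^ 3 + Polynomial.C E.a₂ * Polynomial.X ^ 2
      + Polynomial.C E.a₄ * Polynomial.X + Polynomial.C E.a₆)
    (hp : Irreducible p)
    (d : ℕ) (hd : 3 ≤ d) (hodd : Odd d)
    (Q : (E.baseChange (AlgebraicClosure ℚ)).toAffine.Point) (hQ : addOrderOf Q = 2) :
    (∃! f : RatFunc (AlgebraicClosure ℚ),
      IterateField.DescendsTo (fun P => d • P + Q) f) ∧
    ∀ f : RatFunc (AlgebraicClosure ℚ),
      IterateField.DescendsTo (fun P => d • P + Q) f →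
        f ∈ IterateField.setA ℚ (AlgebraicClosure ℚ) 2 \
          (IterateField.definedOver ℚ (AlgebraicClosure ℚ) ∪
            IterateField.setB ℚ (AlgebraicClosure ℚ)) := by
  obtain ⟨r, hr, rfl⟩ := IterateField.exists_eq_some_zero
    (W := (E.baseChange (AlgebraicClosure ℚ)).toAffine) (by simp [ha₁]) (by simp [ha₃]) hQ
  obtain ⟨A, B, hAB⟩ := WeierstrassCurve.exists_isMulX (AlgebraicClosure ℚ) (W := E) ha₁ ha₃ d
  have hf := IterateField.descendsTo_lattes ha₁ ha₃ hAB hr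
  have huniq {g} (hg) := IterateField.DescendsTo.eq ha₁ ha₃ (f := g) hg hf
  refine ⟨⟨_, hf, fun g hg => huniq hg⟩, fun g hg => ?_⟩
  rw [huniq hg]
  have hdeg : p.natDegree = 3 := by
    rw [hE, ← one_mul (Polynomial.X ^ 3), ← Polynomial.C_1]
    exact Polynomial.natDegree_cubic one_ne_zero
  have hroot : Polynomial.aeval r p = 0 := by
    have := (WeierstrassCurve.Affine.equation_iff ..).mp hr.1
    simp [ha₁, ha₃] at this
    simp [hE, ← this]
  have hfin (x : ℚ) := IterateField.exists_hasValue_lattes (E := E) hp hdeg hroot hAB.isCoprime x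
  have hrr : 3 * r ^ 2 + 2 * (E.baseChange (AlgebraicClosure ℚ)).a₂ * r +
      (E.baseChange (AlgebraicClosure ℚ)).a₄ ≠ 0 := by
    intro h
    have := IterateField.eq_zero_of_quadratic hp hdeg hroot (a := 3) (b := 2 * E.a₂) (c := E.a₄)
      (by simpa using h)
    simp at this
  obtain ⟨h1, h2⟩ := IterateField.lattes_at_infty hAB.isCoprime hrr hAB.degree_lt
  have h2Q (k : ℕ) : (2 * k) • WeierstrassCurve.Affine.Point.some r 0 hr = 0 := by
    rw [mul_comm, mul_smul, ← hQ, addOrderOf_nsmul_eq_zero, smul_zero]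
  have hdQ : d • WeierstrassCurve.Affine.Point.some r 0 hr = .some r 0 hr := by
    obtain ⟨k, rfl⟩ := hodd
    rw [succ_nsmul, h2Q, zero_add]
  -- `Q` itself is a point not killed by `d²`, because `dQ = Q`.
  refine ⟨hf.mem_setA_two ha₁ ha₃ (n := d * d) (fun P => ?_) (P₀ := .some r 0 hr) ?_, ?_⟩
  · rw [smul_add, smul_smul, add_assoc, hdQ, ← two_nsmul, ← mul_one 2, h2Q, add_zero]
  · rw [mul_smul, hdQ, hdQ]
    exact WeierstrassCurve.Affine.Point.some_ne_zero hr
  · rintro (h | h)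
    · exact IterateField.notMem_definedOver hfin h
    · refine IterateField.notMem_setB h1 ?_ hfin h
      rw [h2]
      rintro ⟨s, hs⟩
      have := IterateField.eq_zero_of_quadratic hp hdeg hroot (a := 0) (b := 1) (c := -s)
        (by rw [map_neg, hs]; simp)
      simp at this
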